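/- Let $n\ge 1$ be an integer, $\nu\in\mathbb C$ with $\operatorname{Re}\nu>0$, $p>1+\frac2n$, and let $f:\mathbb C\to\mathbb C$ satisfy $f(0)=0$ and, for some $K>0$, $$|f(\xi)-f(\eta)|\le K\left(|\xi|^{p-1}+|\eta|^{p-1}\right)|\xi-\eta|\qquad\text{for all }\xi,\eta\in\mathbb C .$$ Write $L^q=L^q(\mathbb R^n;\mathbb C)$ with norm $\|\cdot\|_q$, and for an integer $m\ge1$ let $L^1_m$ be the space of all $\varphi\in L^1$ with $x^\alpha\varphi\in L^1$ for all multi-indices $\alpha\in\mathbb Z_{\ge0}^n$ with $|\alpha|\le m$, normed by $\sum_{|\alpha|\le m}\|x^\alpha\varphi\|_1$. For $t>0$ let $e^{t\nu\Delta}\varphi=G_{t\nu}*\varphi$ with $$G_{t\nu}(x)=(4\pi t\nu)^{-n/2}\exp\left(-\frac{|x|^2}{4t\nu}\right)$$ (principal branch), and let $e^{0\nu\Delta}\varphi=\varphi$. For $u_0\in L^1\cap L^\infty$, a global mild solution of $$\partial_tu-\nu\Delta u=f(u),\qquad u(0)=u_0,$$ is a function $$u\in X=(C\cap L^\infty)([0,\infty);L^1)\cap(C\cap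 L^\infty)((0,\infty);L^\infty)$$ such that, for every $t>0$, $$u(t)=e^{t\nu\Delta}u_0+\int_0^te^{(t-s)\nu\Delta}f(u(s))\,ds\qquad\text{in }L^1\cap L^\infty .$$ Theorem. Let $m\ge1$ be an integer, let $u_0\in L^1_m\cap L^\infty$, and let $u\in X$ be any global mild solution satisfying $$\sup_{q\in[1,\infty]}\ \sup_{t>0}\ t^{\frac n2\left(1-\frac1q\right)}\|u(t)\|_q<\infty .$$ Then $u\in C([0,\infty);L^1_m)$, and there is a constant $C>0$ such that $$\sum_{|\alpha|=m}\|x^\alpha u(t)\|_1\le C\left(1+t^{m/2}\right)\qquad\text{for all }t>0 .$$ -/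

import Mathlib

open MeasureTheory Set Filter Topology
open scoped ENNReal

namespace CGL

/-- The space `ℝⁿ` with its Euclidean norm. -/
abbrev Rn (n : ℕ) : Type := EuclideanSpace ℝ (Fin n)

/-- The monomial `x ^ α = ∏ j, x_j ^ α_j` for a multi-index `α`. -/
def monomial {n : ℕ} (α : Fin n → ℕ) (x : Rn n) : ℝ := ∏ j, x j ^ α j

/-- The function `x ↦ x ^ α * φ x`. -/
def weighted {n : ℕ} (α : Fin n → ℕ) (φ : Rn n → ℂ) : Rn n → ℂ :=
  fun x => (monomial α x : ℂ) * φ x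

/-- The finite set of multi-indices `α` with `|α| = k`. -/
def multiIndices (n k : ℕ) : Finset (Fin n → ℕ) := Finset.piAntidiag Finset.univ k

/-- Membership in `L¹_m(ℝⁿ)`: `φ ∈ L¹` and `x ^ α φ ∈ L¹` for all `|α| ≤ m`. -/
def MemL1m {n : ℕ} (m : ℕ) (φ : Rn n → ℂ) : Prop :=
  MemLp φ 1 volume ∧ ∀ α : Fin n → ℕ, ∑ j, α j ≤ m → MemLp (weighted α φ) 1 volume

/-- The norm `∑_{|α| ≤ m} ‖x ^ α φ‖₁` of `L¹_m(ℝⁿ)`, with values in `[0, ∞]`. -/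
noncomputable def normL1m {n : ℕ} (m : ℕ) (φ : Rn n → ℂ) : ℝ≥0∞ :=
  ∑ k ∈ Finset.range (m + 1), ∑ α ∈ multiIndices n k, eLpNorm (weighted α φ) 1 volume

/-- `u ∈ C([0, ∞); L¹_m(ℝⁿ))`. -/
def ContinuousIntoL1m {n : ℕ} (m : ℕ) (u : ℝ → Rn n → ℂ) : Prop :=
  (∀ t, 0 ≤ t → MemL1m m (u t)) ∧
    ∀ t, 0 ≤ t → Tendsto (fun s => normL1m m (u s - u t)) (𝓝[Ici 0] t) (𝓝 0)

/-- The fundamental solution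
`G_{tν}(x) = (4 π t ν) ^ (-n/2) * exp (-|x|² / (4 t ν))` of `∂ₜ u - ν Δ u = 0`; the complex power
is the principal one. -/
noncomputable def kernel {n : ℕ} (ν : ℂ) (t : ℝ) (x : Rn n) : ℂ :=
  (4 * (Real.pi : ℂ) * (t : ℂ) * ν) ^ (-(n : ℂ) / 2) *
    Complex.exp (-((‖x‖ : ℂ) ^ 2) / (4 * (t : ℂ) * ν))

/-- The semigroup `e^{tνΔ}`: convolution with `G_{tν}` for `t > 0`, the identity for `t = 0`
(and, by convention, for `t < 0`, which is never used). -/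
noncomputable def semigroup {n : ℕ} (ν : ℂ) (t : ℝ) (φ : Rn n → ℂ) : Rn n → ℂ :=
  if 0 < t then convolution (kernel ν t) φ (ContinuousLinearMap.mul ℂ ℂ) volume else φ

open Classical in
/-- The class in `L^q(ℝⁿ)` of a function `φ` that belongs to it (`0` for other functions). -/
noncomputable def lpClass {n : ℕ} (q : ℝ≥0∞) (φ : Rn n → ℂ) : Lp ℂ q (volume : Measure (Rn n)) :=
  if h : MemLp φ q volume then h.toLp φ else 0

/-- `u ∈ (C ∩ L^∞)(I; L^q(ℝⁿ))`: a continuous and bounded `L^q`-valued function of `t ∈ I`. -/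
structure BoundedContinuousInto {n : ℕ} (q : ℝ≥0∞) [Fact (1 ≤ q)] (I : Set ℝ)
    (u : ℝ → Rn n → ℂ) : Prop where
  memLp : ∀ t ∈ I, MemLp (u t) q volume
  continuousOn : ContinuousOn (fun t => lpClass q (u t)) I
  bounded : ∃ M : ℝ, ∀ t ∈ I, ‖lpClass q (u t)‖ ≤ M

/-- The space `X = (C ∩ L^∞)([0, ∞); L¹) ∩ (C ∩ L^∞)((0, ∞); L^∞)`. -/
def MemX {n : ℕ} (u : ℝ → Rn n → ℂ) : Prop :=
  BoundedContinuousInto 1 (Ici 0) u ∧ BoundedContinuousInto ∞ (Ioi 0) u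

/-- The equation `u(t) = e^{tνΔ} u₀ + ∫₀ᵗ e^{(t-s)νΔ} f(u(s)) ds` in `L^q(ℝⁿ)`, with the
Bochner integral of `L^q(ℝⁿ)`. -/
def DuhamelAt {n : ℕ} (q : ℝ≥0∞) [Fact (1 ≤ q)] (ν : ℂ) (f : ℂ → ℂ) (u₀ : Rn n → ℂ)
    (u : ℝ → Rn n → ℂ) (t : ℝ) : Prop :=
  lpClass q (u t) = lpClass q (semigroup ν t u₀) +
    ∫ s in (0 : ℝ)..t, lpClass q (semigroup ν (t - s) (fun x => f (u s x)))

/-- `u` is a global (mild) solution of `∂ₜ u - ν Δ u = f(u)`, `u(0) = u₀`: it belongs to `X` and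
the integral equation holds in `L¹ ∩ L^∞` for all `t > 0`. -/
structure IsGlobalMildSolution {n : ℕ} (ν : ℂ) (f : ℂ → ℂ) (u₀ : Rn n → ℂ)
    (u : ℝ → Rn n → ℂ) : Prop where
  memX : MemX u
  duhamel : ∀ t, 0 < t → DuhamelAt 1 ν f u₀ u t ∧ DuhamelAt ∞ ν f u₀ u t

/-- `sup_{q ∈ [1, ∞]} sup_{t > 0} t ^ (n/2 * (1 - 1/q)) * ‖u(t)‖_q < ∞`. -/
def DecaysLikeFree {n : ℕ} (u : ℝ → Rn n → ℂ) : Prop :=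
  (⨆ q ∈ Ici (1 : ℝ≥0∞), ⨆ t ∈ Ioi (0 : ℝ),
    ENNReal.ofReal (t ^ ((n : ℝ) / 2 * (1 - (q⁻¹).toReal))) * eLpNorm (u t) q volume) < ∞

end CGL

/-!
The proof compares weighted `L¹` norms of the solution with those of the datum and of the heat
kernel. Write `W_w(φ) = ∫ w |φ|` (`weightedMass`) for a weight `w` with
`w (x + y) ≤ D (w x + w y)` (`IsQuasiSubadditive`). Then `weightedMass_convolution_le` gives
`W_w(G * φ) ≤ D (W_w(G) ‖φ‖₁ + ‖G‖₁ W_w(φ))`. The growth condition on `f` yields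
`|f(u(s))| ≤ b(s) |u(s)|` with `b(s) = c (1 + s) ^ (-n (p - 1) / 2)`, because `u(s)` is bounded in
`L^∞` and decays there like `s ^ (-n / 2)`; since `p > 1 + 2 / n`, the rate `b` is integrable in
time (`exists_integrable_rate`). The integral equation and Grönwall's inequality therefore bound
`W_w(u(t))`, for all `t ∈ [0, T]`, by a constant times `W_w(u₀) + sup_{0 < s ≤ T} W_w(G_{sν})`. In
order that the quantity in Grönwall's inequality is known to be finite and continuous, this is
first done for bounded weights; as the constant depends on `w` only through `D`, truncation gives
the general case (`exists_weightedMass_le`).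

For `w = |x| ^ m` the kernel contributes `O(T ^ (m / 2))`, which is the moment bound. For
`w = |x| ^ m min(1, |x| / R)` (`tailWeight`) the kernel contributes `O(T ^ ((m + 1) / 2) / R)`, and
the datum contributes a quantity that tends to zero as `R → ∞`. Hence the tails of
`|x| ^ m |u(t)|` are small uniformly on `[0, T]`, and continuity in `L¹` upgrades to continuity in
`L¹_m` (`tendsto_normL1m_sub`).
-/

open scoped NNReal

namespace CGL

variable {n : ℕ}

/-! ### Absolute moments of the heat kernel -/

lemma norm_kernel (ν : ℂ) {t : ℝ} (ht : 0 < t) (x : Rn n) :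
    ‖kernel ν t x‖ = (4 * Real.pi * t * ‖ν‖) ^ (-(n : ℝ) / 2) *
      Real.exp (-(ν.re / (4 * ‖ν‖ ^ 2) / t * ‖x‖ ^ 2)) := by
  have h1 : (-(n : ℂ) / 2) = ((-(n : ℝ) / 2 : ℝ) : ℂ) := by push_cast; rfl
  have h2 : (-((‖x‖ : ℂ) ^ 2) / (4 * (t : ℂ) * ν)).re
      = -(ν.re / (4 * ‖ν‖ ^ 2) / t * ‖x‖ ^ 2) := by
    have : (-((‖x‖ : ℂ) ^ 2) / (4 * (t : ℂ) * ν)) = ((-(‖x‖ ^ 2) / (4 * t) : ℝ) : ℂ) * ν⁻¹ := by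
      push_cast
      rw [div_eq_mul_inv, div_eq_mul_inv, mul_inv]
      ring
    rw [this, Complex.re_ofReal_mul, Complex.inv_re, Complex.normSq_eq_norm_sq]
    have := ht.ne'
    field_simp
  rw [kernel, norm_mul, h1, Complex.norm_cpow_real, Complex.norm_exp, h2]
  congr 2
  simp [abs_of_pos ht, abs_of_pos Real.pi_pos]

lemma continuous_kernel (ν : ℂ) (t : ℝ) : Continuous (kernel ν t : Rn n → ℂ) := by
  unfold kernel
  fun_prop

/-- Half of the Gaussian decay absorbs any power of `r / √t`. -/
lemma pow_mul_exp_le (k : ℕ) {δ t r : ℝ} (hδ : 0 < δ) (ht : 0 < t) (hr : 0 ≤ r) :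
    r ^ k * Real.exp (-(δ / t * r ^ 2)) ≤
      k.factorial * Real.exp (1 / (2 * δ)) * t ^ ((k : ℝ) / 2) *
        Real.exp (-(δ / (2 * t)) * r ^ 2) := by
  set y := r / √t with hy
  have hst : 0 < √t := Real.sqrt_pos.2 ht
  have hy0 : 0 ≤ y := by positivity
  have hry : r = y * √t := by rw [hy]; field_simp
  have hsq : r ^ 2 = y ^ 2 * t := by rw [hry, mul_pow, Real.sq_sqrt ht.le]
  have hpow : √t ^ k = t ^ ((k : ℝ) / 2) := by
    rw [Real.sqrt_eq_rpow, ← Real.rpow_natCast, ← Real.rpow_mul ht.le]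
    congr 1
    ring
  have h1 : y ^ k ≤ k.factorial * Real.exp y := by
    have := Real.pow_div_factorial_le_exp y hy0 k
    rwa [div_le_iff₀' (by positivity)] at this
  have h2 : y ≤ 1 / (2 * δ) + δ / 2 * y ^ 2 := by
    have : 0 ≤ (δ * y - 1) ^ 2 / (2 * δ) := by positivity
    have h3 : (δ * y - 1) ^ 2 / (2 * δ) = 1 / (2 * δ) + δ / 2 * y ^ 2 - y := by
      field_simp
      ring
    linarith
  have e1 : δ / t * r ^ 2 = δ * y ^ 2 := by rw [hsq]; field_simp
  have e2 : -(δ / (2 * t)) * r ^ 2 = -(δ / 2 * y ^ 2) := by rw [hsq]; field_simp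
  rw [e1, e2]
  nth_rewrite 1 [hry]
  rw [mul_pow, hpow]
  calc y ^ k * t ^ ((k : ℝ) / 2) * Real.exp (-(δ * y ^ 2))
      ≤ (k.factorial * Real.exp (1 / (2 * δ) + δ / 2 * y ^ 2)) * t ^ ((k : ℝ) / 2) *
        Real.exp (-(δ * y ^ 2)) := by
        gcongr
        exact h1.trans (by gcongr)
    _ = k.factorial * Real.exp (1 / (2 * δ)) * t ^ ((k : ℝ) / 2) *
        (Real.exp (δ / 2 * y ^ 2) * Real.exp (-(δ * y ^ 2))) := by
        rw [Real.exp_add]; ring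
    _ = _ := by
        rw [← Real.exp_add]
        congr 2
        ring

lemma exists_lintegral_pow_mul_kernel_le {ν : ℂ} (hν : 0 < ν.re) (k : ℕ) :
    ∃ C : ℝ≥0, ∀ t : ℝ, 0 < t →
      ∫⁻ x : Rn n, ‖x‖ₑ ^ k * ‖kernel ν t x‖ₑ ≤ C * ENNReal.ofReal (t ^ ((k : ℝ) / 2)) := by
  have hν0 : 0 < ‖ν‖ := norm_pos_iff.2 (fun h => by simp [h] at hν)
  set δ := ν.re / (4 * ‖ν‖ ^ 2) with hδdef
  have hδ : 0 < δ := by positivity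
  set E := k.factorial * Real.exp (1 / (2 * δ)) with hE
  set c₁ := (4 * Real.pi * ‖ν‖) ^ (-(n : ℝ) / 2) with hc₁
  set c₂ := (2 * Real.pi / δ) ^ ((n : ℝ) / 2) with hc₂
  have hc₁0 : 0 ≤ c₁ := by positivity
  have hc₂0 : 0 ≤ c₂ := by positivity
  have hE0 : 0 ≤ E := by positivity
  refine ⟨(c₁ * E * c₂).toNNReal, fun t ht => ?_⟩
  have hpre : (4 * Real.pi * t * ‖ν‖) ^ (-(n : ℝ) / 2) = t ^ (-(n : ℝ) / 2) * c₁ := by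
    rw [show 4 * Real.pi * t * ‖ν‖ = t * (4 * Real.pi * ‖ν‖) by ring,
      Real.mul_rpow ht.le (by positivity)]
  have hbpos : 0 < δ / (2 * t) := by positivity
  have hgauss := GaussianFourier.integral_rexp_neg_mul_sq_norm (V := Rn n) hbpos
  have hval : (Real.pi / (δ / (2 * t))) ^ ((n : ℝ) / 2) = t ^ ((n : ℝ) / 2) * c₂ := by
    rw [show Real.pi / (δ / (2 * t)) = t * (2 * Real.pi / δ) by field_simp,
      Real.mul_rpow ht.le (by positivity)]
  rw [finrank_euclideanSpace, Fintype.card_fin, hval] at hgauss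
  have hint : Integrable (fun x : Rn n => Real.exp (-(δ / (2 * t)) * ‖x‖ ^ 2)) := by
    -- a non-integrable function would have integral zero
    by_contra h
    rw [integral_undef h] at hgauss
    have : 0 < t ^ ((n : ℝ) / 2) * c₂ := by positivity
    linarith
  have hpt : ∀ x : Rn n, ‖x‖ₑ ^ k * ‖kernel ν t x‖ₑ ≤
      ENNReal.ofReal (t ^ (-(n : ℝ) / 2) * c₁ * E * t ^ ((k : ℝ) / 2)) *
        ENNReal.ofReal (Real.exp (-(δ / (2 * t)) * ‖x‖ ^ 2)) := by
    intro x
    rw [← ofReal_norm, ← ofReal_norm, ← ENNReal.ofReal_pow (norm_nonneg _),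
      ← ENNReal.ofReal_mul (by positivity), ← ENNReal.ofReal_mul (by positivity)]
    apply ENNReal.ofReal_le_ofReal
    rw [norm_kernel ν ht, hpre]
    have := pow_mul_exp_le k hδ ht (norm_nonneg x)
    calc _ = (t ^ (-(n : ℝ) / 2) * c₁) * (‖x‖ ^ k * Real.exp (-(δ / t * ‖x‖ ^ 2))) := by ring
      _ ≤ (t ^ (-(n : ℝ) / 2) * c₁) * _ := mul_le_mul_of_nonneg_left this (by positivity)
      _ = _ := by rw [hE]; ring
  refine (lintegral_mono hpt).trans ?_
  rw [lintegral_const_mul' _ _ ENNReal.ofReal_ne_top,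
    ← ofReal_integral_eq_lintegral_ofReal hint (Eventually.of_forall fun _ => by positivity),
    hgauss, ← ENNReal.ofReal_mul (by positivity)]
  change _ ≤ ENNReal.ofReal _ * _
  rw [← ENNReal.ofReal_mul (by positivity)]
  apply le_of_eq
  congr 1
  have : t ^ (-(n : ℝ) / 2) * t ^ ((n : ℝ) / 2) = 1 := by
    rw [← Real.rpow_add ht, neg_div, neg_add_cancel, Real.rpow_zero]
  calc _ = (t ^ (-(n : ℝ) / 2) * t ^ ((n : ℝ) / 2)) * (c₁ * E * c₂ * t ^ ((k : ℝ) / 2)) := by ring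
    _ = _ := by rw [this, one_mul]

/-! ### Weighted masses and convolution -/

/-- The weighted mass `∫ w |φ|` of `φ`, with values in `[0, ∞]`. -/
noncomputable def weightedMass (w : Rn n → ℝ≥0) (φ : Rn n → ℂ) : ℝ≥0∞ :=
  ∫⁻ x, w x * ‖φ x‖ₑ

/-- A measurable weight `w` with `w (x + y) ≤ D (w x + w y)`. -/
structure IsQuasiSubadditive (D : ℝ≥0) (w : Rn n → ℝ≥0) : Prop where
  measurable : Measurable w
  add_le : ∀ x y, w (x + y) ≤ D * (w x + w y)

lemma weightedMass_mono {v w : Rn n → ℝ≥0} (h : ∀ x, v x ≤ w x) (φ : Rn n → ℂ) :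
    weightedMass v φ ≤ weightedMass w φ := by
  unfold weightedMass
  gcongr with x
  exact h x

lemma weightedMass_le_of_ae_norm_le {w : Rn n → ℝ≥0} {φ ψ : Rn n → ℂ} {b : ℝ}
    (hb : 0 ≤ b) (h : ∀ᵐ x, ‖φ x‖ ≤ b * ‖ψ x‖) :
    weightedMass w φ ≤ ENNReal.ofReal b * weightedMass w ψ := by
  unfold weightedMass
  rw [← lintegral_const_mul' _ _ ENNReal.ofReal_ne_top]
  refine lintegral_mono_ae (h.mono fun x hx => ?_)
  rw [mul_left_comm, ← ofReal_norm, ← ofReal_norm, ← ENNReal.ofReal_mul hb]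
  gcongr

lemma weightedMass_convolution_le {D : ℝ≥0} {w : Rn n → ℝ≥0} (hw : IsQuasiSubadditive D w)
    {G φ : Rn n → ℂ} (hG : Measurable G) (hφ : AEStronglyMeasurable φ volume) :
    weightedMass w (convolution G φ (ContinuousLinearMap.mul ℂ ℂ) volume) ≤
      D * (weightedMass w G * weightedMass 1 φ + weightedMass 1 G * weightedMass w φ) := by
  have hwm : Measurable fun x => (w x : ℝ≥0∞) := hw.measurable.coe_nnreal_ennreal
  have hmp : ∀ y : Rn n, MeasurePreserving (fun x => x - y) volume volume :=
    fun y => measurePreserving_sub_right volume y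
  have hφ2 : AEStronglyMeasurable (fun z : Rn n × Rn n => φ (z.1 - z.2))
      ((volume : Measure (Rn n)).prod volume) :=
    hφ.comp_quasiMeasurePreserving (quasiMeasurePreserving_sub_of_right_invariant volume volume)
  calc weightedMass w (convolution G φ (ContinuousLinearMap.mul ℂ ℂ) volume)
      ≤ ∫⁻ x, ∫⁻ y, D * ((w y + w (x - y)) * (‖G y‖ₑ * ‖φ (x - y)‖ₑ)) := by
        refine lintegral_mono fun x => ?_
        calc (w x : ℝ≥0∞) * ‖∫ y, G y * φ (x - y)‖ₑ
            ≤ w x * ∫⁻ y, ‖G y * φ (x - y)‖ₑ := by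
              gcongr
              exact enorm_integral_le_lintegral_enorm _
          _ = ∫⁻ y, w x * (‖G y‖ₑ * ‖φ (x - y)‖ₑ) := by
              rw [← lintegral_const_mul' _ _ ENNReal.coe_ne_top]
              simp_rw [enorm_mul]
          _ ≤ _ := by
              refine lintegral_mono fun y => ?_
              rw [← mul_assoc (D : ℝ≥0∞)]
              gcongr
              have := hw.add_le y (x - y)
              rw [add_sub_cancel] at this
              rw [← ENNReal.coe_add, ← ENNReal.coe_mul]
              exact ENNReal.coe_le_coe.2 this
    _ = ∫⁻ y, ∫⁻ x, D * ((w y + w (x - y)) * (‖G y‖ₑ * ‖φ (x - y)‖ₑ)) := by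
        refine lintegral_lintegral_swap ?_
        have h1 : Measurable fun z : Rn n × Rn n => (w z.2 + w (z.1 - z.2) : ℝ≥0∞) :=
          (hwm.comp measurable_snd).add (hwm.comp (measurable_fst.sub measurable_snd))
        have h2 : Measurable fun z : Rn n × Rn n => ‖G z.2‖ₑ := (hG.comp measurable_snd).enorm
        exact (h1.aemeasurable.mul (h2.aemeasurable.mul hφ2.enorm)).const_mul _
    _ = ∫⁻ y, D * (w y * ‖G y‖ₑ * weightedMass 1 φ + 1 * ‖G y‖ₑ * weightedMass w φ) := by
        refine lintegral_congr fun y => ?_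
        have hL : weightedMass 1 φ = ∫⁻ x, ‖φ (x - y)‖ₑ := by
          rw [lintegral_sub_right_eq_self (fun x => ‖φ x‖ₑ)]
          simp [weightedMass]
        have hW : weightedMass w φ = ∫⁻ x, w (x - y) * ‖φ (x - y)‖ₑ := by
          rw [lintegral_sub_right_eq_self (fun x => w x * ‖φ x‖ₑ)]
          rfl
        have hm : AEMeasurable (fun x => w y * ‖G y‖ₑ * ‖φ (x - y)‖ₑ) volume :=
          ((hφ.comp_measurePreserving (hmp y)).enorm).const_mul _
        rw [lintegral_const_mul' _ _ ENNReal.coe_ne_top]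
        congr 1
        rw [hL, hW, one_mul, ← lintegral_const_mul' _ _ (by finiteness),
          ← lintegral_const_mul' _ _ (by finiteness), ← lintegral_add_left' hm]
        refine lintegral_congr fun x => ?_
        ring
    _ = _ := by
        rw [lintegral_const_mul' _ _ ENNReal.coe_ne_top, lintegral_add_left]
        · congr 2
          · exact lintegral_mul_const _ (hwm.mul hG.enorm)
          · exact lintegral_mul_const _ (measurable_const.mul hG.enorm)
        · exact (hwm.mul hG.enorm).mul_const _

/-! ### Grönwall's inequality in integral form -/

/-- The hypothesis is not made at `t = 0`, where it holds by continuity. -/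
lemma le_mul_exp_of_le_add_integral {ψ b : ℝ → ℝ} {A T : ℝ} (hT : 0 < T)
    (hψ : ContinuousOn ψ (Ici 0)) (hb : Continuous b) (hb0 : ∀ s, 0 ≤ b s)
    (h : ∀ t ∈ Ioc 0 T, ψ t ≤ A + ∫ s in (0 : ℝ)..t, b s * ψ s) :
    ∀ t ∈ Icc 0 T, ψ t ≤ A * Real.exp (∫ s in (0 : ℝ)..t, b s) := by
  set χ : ℝ → ℝ := fun s => ψ (max s 0) with hχ
  have hχc : Continuous χ := hψ.comp_continuous (by fun_prop) (fun s => mem_Ici.2 (le_max_right s 0))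
  have hχe : ∀ s, 0 ≤ s → χ s = ψ s := fun s hs => by simp [hχ, max_eq_left hs]
  have hbχ : Continuous fun s => b s * χ s := hb.mul hχc
  set F : ℝ → ℝ := fun t => A + ∫ s in (0 : ℝ)..t, b s * χ s with hF
  set β : ℝ → ℝ := fun t => ∫ s in (0 : ℝ)..t, b s with hβ
  have hFd : ∀ t, HasDerivAt F (b t * χ t) t := fun t =>
    (intervalIntegral.integral_hasDerivAt_right (hbχ.intervalIntegrable _ _)
      (hbχ.stronglyMeasurableAtFilter _ _) hbχ.continuousAt).const_add A
  have hβd : ∀ t, HasDerivAt β (b t) t := fun t =>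
    intervalIntegral.integral_hasDerivAt_right (hb.intervalIntegrable _ _)
      (hb.stronglyMeasurableAtFilter _ _) hb.continuousAt
  have hFc : Continuous F := continuous_iff_continuousAt.2 fun t => (hFd t).continuousAt
  have hle : ∀ t ∈ Icc 0 T, χ t ≤ F t := by
    intro t ht
    rw [← closure_Ioo hT.ne] at ht
    refine le_on_closure (s := Ioo 0 T) ?_ hχc.continuousOn hFc.continuousOn ht
    intro s hs
    rw [hχe s hs.1.le]
    refine (h s ⟨hs.1, hs.2.le⟩).trans_eq ?_
    simp only [hF]
    congr 1
    refine intervalIntegral.integral_congr fun r hr => ?_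
    rw [uIcc_of_le hs.1.le] at hr
    simp [hχe r hr.1]
  have hHd : ∀ t, HasDerivAt (fun t => F t * Real.exp (-β t))
      (b t * χ t * Real.exp (-β t) + F t * (Real.exp (-β t) * -b t)) t := fun t =>
    (hFd t).mul ((hβd t).neg.exp)
  have hanti : AntitoneOn (fun t => F t * Real.exp (-β t)) (Icc 0 T) := by
    refine antitoneOn_of_deriv_nonpos (convex_Icc 0 T)
      (fun t _ => (hHd t).continuousAt.continuousWithinAt)
      (fun t _ => (hHd t).differentiableAt.differentiableWithinAt) fun t ht => ?_
    rw [interior_Icc] at ht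
    rw [(hHd t).deriv]
    have h1 := hle t ⟨ht.1.le, ht.2.le⟩
    have h2 : 0 ≤ b t * Real.exp (-β t) := mul_nonneg (hb0 t) (Real.exp_pos _).le
    nlinarith
  intro t ht
  have h1 := hanti (left_mem_Icc.2 hT.le) ht ht.1
  have h0 : F 0 * Real.exp (-β 0) = A := by simp [hF, hβ]
  simp only [h0] at h1
  rw [← hχe t ht.1]
  refine (hle t ht).trans ?_
  rwa [Real.exp_neg, ← div_eq_mul_inv, div_le_iff₀ (Real.exp_pos _)] at h1

/-! ### Propagation of weighted masses by the integral equation -/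

lemma lpClass_of_memLp {q : ℝ≥0∞} {φ : Rn n → ℂ} (h : MemLp φ q volume) :
    lpClass q φ = h.toLp φ := dif_pos h

lemma lpClass_of_not_memLp {q : ℝ≥0∞} {φ : Rn n → ℂ} (h : ¬ MemLp φ q volume) :
    lpClass q φ = 0 := dif_neg h

lemma enorm_lpClass {q : ℝ≥0∞} {φ : Rn n → ℂ} (h : MemLp φ q volume) :
    ‖lpClass q φ‖ₑ = eLpNorm φ q volume := by
  rw [lpClass_of_memLp h, Lp.enorm_toLp]

lemma weightedMass_one (φ : Rn n → ℂ) : weightedMass 1 φ = eLpNorm φ 1 volume := by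
  simp [weightedMass, eLpNorm_one_eq_lintegral_enorm]

/-- Multiplication by a bounded weight as an operator on `L¹`. It is continuous and linear, so it
can be applied to the Bochner integral in the integral equation. -/
lemma exists_multiplier {w : Rn n → ℝ≥0} (hw : Measurable w) {N : ℝ≥0} (hN : ∀ x, w x ≤ N) :
    ∃ T : Lp ℂ 1 (volume : Measure (Rn n)) →L[ℂ] Lp ℂ 1 (volume : Measure (Rn n)),
      ∀ φ, MemLp φ 1 volume → ‖T (lpClass 1 φ)‖ₑ = weightedMass w φ := by
  have hwL : MemLp (fun x => ((w x : ℝ) : ℂ)) ∞ (volume : Measure (Rn n)) := by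
    refine memLp_top_of_bound ?_ N (Eventually.of_forall fun x => ?_)
    · exact (Complex.measurable_ofReal.comp hw.coe_nnreal_real).aestronglyMeasurable
    · simpa using hN x
  refine ⟨(ContinuousLinearMap.mul ℂ ℂ).holderL volume ∞ 1 1 (hwL.toLp _), fun φ hφ => ?_⟩
  rw [lpClass_of_memLp hφ, ContinuousLinearMap.holderL_apply_apply, Lp.enorm_def,
    eLpNorm_one_eq_lintegral_enorm]
  refine lintegral_congr_ae ?_
  filter_upwards [ContinuousLinearMap.coeFn_holder (r := 1) (ContinuousLinearMap.mul ℂ ℂ)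
    (hwL.toLp _) (hφ.toLp φ), hwL.coeFn_toLp, hφ.coeFn_toLp] with x h1 h2 h3
  rw [h1, h2, h3, ContinuousLinearMap.mul_apply', enorm_mul]
  congr 1
  rw [← ofReal_norm, Complex.norm_real, Real.norm_of_nonneg (w x).coe_nonneg]
  exact ENNReal.ofReal_coe_nnreal

/-- No integrability of `v` is needed: otherwise its integral is zero by convention. -/
lemma norm_apply_integral_le {E : Type*} [NormedAddCommGroup E] [NormedSpace ℂ E] [CompleteSpace E]
    (T : E →L[ℂ] E) {v : ℝ → E} {g : ℝ → ℝ} {t : ℝ} (ht : 0 ≤ t)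
    (hg : IntervalIntegrable g volume 0 t) (h : ∀ s ∈ Ioo 0 t, ‖T (v s)‖ ≤ g s) :
    ‖T (∫ s in (0 : ℝ)..t, v s)‖ ≤ ∫ s in (0 : ℝ)..t, g s := by
  have hae : ∀ᵐ s, s ∈ Ioc 0 t → ‖T (v s)‖ ≤ g s := by
    filter_upwards [Measure.ae_ne volume t] with s hs hst
    exact h s ⟨hst.1, lt_of_le_of_ne hst.2 hs⟩
  have hle := intervalIntegral.norm_integral_le_of_norm_le ht hae hg
  by_cases hv : IntervalIntegrable v volume 0 t
  · rwa [T.intervalIntegral_comp_comm hv] at hle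
  · rw [intervalIntegral.integral_undef hv, map_zero, norm_zero]
    exact (norm_nonneg _).trans hle

/-- Grönwall's inequality for `t ↦ ∫ w |u(t)|` with a bounded weight `w`. Boundedness makes this
function finite and continuous on `[0, ∞)` because `u` is continuous with values in `L¹`; the bound
`N` does not enter the estimate. -/
lemma weightedMass_le_of_bounded {ν : ℂ} {f : ℂ → ℂ} (hf : Continuous f) {u₀ : Rn n → ℂ}
    {u : ℝ → Rn n → ℂ} (hu₀ : MemLp u₀ 1 volume) (hu : BoundedContinuousInto 1 (Ici 0) u)
    (hdu : ∀ t, 0 < t → DuhamelAt 1 ν f u₀ u t) {b : ℝ → ℝ} (hb : Continuous b)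
    (hb0 : ∀ s, 0 ≤ b s) (hbi : Integrable b)
    (hfb : ∀ s, 0 < s → ∀ᵐ x, ‖f (u s x)‖ ≤ b s * ‖u s x‖)
    {D g U M κ W : ℝ≥0} (hg : ∀ t, 0 < t → weightedMass (n := n) 1 (kernel ν t) ≤ g)
    (hU : weightedMass 1 u₀ ≤ U) (hM : ∀ t, 0 ≤ t → weightedMass 1 (u t) ≤ M)
    {w : Rn n → ℝ≥0} (hw : IsQuasiSubadditive D w) {N : ℝ≥0} (hN : ∀ x, w x ≤ N)
    {T : ℝ} (hT : 0 < T) (hκ : ∀ s ∈ Ioc 0 T, weightedMass w (kernel ν s) ≤ κ)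
    (hW : weightedMass w u₀ ≤ W) {t : ℝ} (ht : t ∈ Icc 0 T) :
    weightedMass w (u t) ≤
      ENNReal.ofReal (D * (κ * U + g * W + κ * M * ∫ s, b s) * Real.exp (D * g * ∫ s, b s)) := by
  obtain ⟨L, hL⟩ := exists_multiplier hw.measurable hN
  have hL' : ∀ φ, ‖L (lpClass 1 φ)‖ₑ ≤ weightedMass w φ := by
    intro φ
    by_cases hφ : MemLp φ 1 volume
    · exact (hL φ hφ).le
    · simp [lpClass_of_not_memLp hφ]
  have hLr : ∀ φ (r : ℝ), 0 ≤ r → weightedMass w φ ≤ ENNReal.ofReal r →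
      ‖L (lpClass 1 φ)‖ ≤ r := by
    intro φ r hr h
    rw [← ENNReal.ofReal_le_ofReal_iff hr, ofReal_norm]
    exact (hL' φ).trans h
  set ψ : ℝ → ℝ := fun t => ‖L (lpClass 1 (u t))‖ with hψdef
  have hψ0 : ∀ t, 0 ≤ ψ t := fun t => norm_nonneg _
  have hψ : ∀ t, 0 ≤ t → weightedMass w (u t) = ENNReal.ofReal (ψ t) := by
    intro t ht
    rw [hψdef, ofReal_norm, hL _ (hu.memLp t ht)]
  have hψc : ContinuousOn ψ (Ici 0) := (L.continuous.comp_continuousOn hu.continuousOn).norm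
  set B := ∫ s, b s with hB
  have hB0 : 0 ≤ B := integral_nonneg hb0
  have hbB : ∀ t, 0 ≤ t → ∫ s in (0 : ℝ)..t, b s ≤ B := by
    intro t ht
    rw [intervalIntegral.integral_of_le ht]
    exact setIntegral_le_integral hbi (Eventually.of_forall hb0)
  -- one application of the semigroup costs the weighted mass of the kernel
  have hsg : ∀ (τ : ℝ) (φ : Rn n → ℂ) (p q : ℝ), τ ∈ Ioc 0 T → AEStronglyMeasurable φ volume →
      0 ≤ p → 0 ≤ q → weightedMass 1 φ ≤ ENNReal.ofReal p → weightedMass w φ ≤ ENNReal.ofReal q →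
      ‖L (lpClass 1 (semigroup ν τ φ))‖ ≤ D * (κ * p + g * q) := by
    intro τ φ p q hτ hφ hp hq h1 hw1
    refine hLr _ _ (by positivity) ?_
    rw [semigroup, if_pos hτ.1]
    refine (weightedMass_convolution_le hw (continuous_kernel ν τ).measurable hφ).trans ?_
    have hc : ∀ a : ℝ≥0, (a : ℝ≥0∞) = ENNReal.ofReal a := fun a => ENNReal.ofReal_coe_nnreal.symm
    rw [ENNReal.ofReal_mul D.coe_nonneg, ENNReal.ofReal_add (by positivity) (by positivity),
      ENNReal.ofReal_mul κ.coe_nonneg, ENNReal.ofReal_mul g.coe_nonneg, ← hc, ← hc, ← hc]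
    gcongr
    · exact hκ τ hτ
    · exact hg τ hτ.1
  set A := (D : ℝ) * (κ * U + g * W + κ * M * B) with hA
  have hA0 : 0 ≤ A := by positivity
  have hkey : ∀ t ∈ Ioc 0 T, ψ t ≤ A + ∫ s in (0 : ℝ)..t, (D * g * b s) * ψ s := by
    intro t ht
    have hsub : uIcc 0 t ⊆ Ici 0 := by
      rw [uIcc_of_le ht.1.le]
      exact fun s hs => hs.1
    have hfree : ‖L (lpClass 1 (semigroup ν t u₀))‖ ≤ D * (κ * U + g * W) :=
      hsg t u₀ U W ht hu₀.1 U.coe_nonneg W.coe_nonneg (by rwa [ENNReal.ofReal_coe_nnreal])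
        (by rwa [ENNReal.ofReal_coe_nnreal])
    have hforce : ∀ s ∈ Ioo 0 t, ‖L (lpClass 1 (semigroup ν (t - s) fun x => f (u s x)))‖ ≤
        (D * κ * M) * b s + (D * g * b s) * ψ s := by
      intro s hs
      have hm := hf.comp_aestronglyMeasurable (hu.memLp s hs.1.le).1
      refine (hsg (t - s) (fun x => f (u s x)) (b s * M) (b s * ψ s)
        ⟨sub_pos.2 hs.2, by linarith [hs.1, ht.2]⟩ hm (mul_nonneg (hb0 s) M.coe_nonneg)
        (mul_nonneg (hb0 s) (hψ0 s)) ?_ ?_).trans (le_of_eq (by ring))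
      · refine (weightedMass_le_of_ae_norm_le (hb0 s) (hfb s hs.1)).trans ?_
        rw [ENNReal.ofReal_mul (hb0 s), ENNReal.ofReal_coe_nnreal]
        gcongr
        exact hM s hs.1.le
      · refine (weightedMass_le_of_ae_norm_le (hb0 s) (hfb s hs.1)).trans ?_
        rw [ENNReal.ofReal_mul (hb0 s), hψ s hs.1.le]
    have hi1 : IntervalIntegrable (fun s => (D * κ * M) * b s) volume 0 t :=
      (continuous_const.mul hb).intervalIntegrable _ _
    have hi2 : IntervalIntegrable (fun s => (D * g * b s) * ψ s) volume 0 t :=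
      ((continuous_const.mul hb).continuousOn.mul (hψc.mono hsub)).intervalIntegrable
    have hint := norm_apply_integral_le L ht.1.le (hi1.add hi2) hforce
    have hd := hdu t ht.1
    unfold DuhamelAt at hd
    calc ψ t ≤ ‖L (lpClass 1 (semigroup ν t u₀))‖ +
          ‖L (∫ s in (0 : ℝ)..t, lpClass 1 (semigroup ν (t - s) fun x => f (u s x)))‖ := by
          rw [hψdef]
          dsimp only
          rw [hd, map_add]
          exact norm_add_le _ _
      _ ≤ D * (κ * U + g * W) +
          ((D * κ * M) * (∫ s in (0 : ℝ)..t, b s) + ∫ s in (0 : ℝ)..t, (D * g * b s) * ψ s) := by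
          rw [intervalIntegral.integral_add hi1 hi2, intervalIntegral.integral_const_mul] at hint
          exact add_le_add hfree hint
      _ ≤ D * (κ * U + g * W) +
          ((D * κ * M) * B + ∫ s in (0 : ℝ)..t, (D * g * b s) * ψ s) := by
          gcongr
          exact hbB t ht.1.le
      _ = _ := by rw [hA]; ring
  have hfin := le_mul_exp_of_le_add_integral (b := fun s => D * g * b s) hT hψc
    (continuous_const.mul hb)
    (fun s => mul_nonneg (by positivity) (hb0 s)) hkey t ht
  rw [hψ t ht.1]
  refine ENNReal.ofReal_le_ofReal (hfin.trans ?_)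
  rw [intervalIntegral.integral_const_mul]
  gcongr
  exact hbB t ht.1

lemma IsQuasiSubadditive.min_const {D : ℝ≥0} (hD : 1 ≤ D) {w : Rn n → ℝ≥0}
    (hw : IsQuasiSubadditive D w) (N : ℝ≥0) : IsQuasiSubadditive D fun x => min (w x) N := by
  refine ⟨hw.measurable.min measurable_const, fun x y => ?_⟩
  have hle : ∀ z, N ≤ w z → N ≤ D * N := fun z _ => le_mul_of_one_le_left N.2 hD
  rcases le_total N (w x) with hx | hx
  · rw [min_eq_right hx]
    exact (min_le_right _ _).trans ((hle x hx).trans (by gcongr; exact le_self_add))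
  rcases le_total N (w y) with hy | hy
  · rw [min_eq_right hy]
    exact (min_le_right _ _).trans ((hle y hy).trans (by gcongr; exact le_add_self))
  rw [min_eq_left hx, min_eq_left hy]
  exact (min_le_left _ _).trans (hw.add_le x y)

lemma weightedMass_le_of_forall_min {w : Rn n → ℝ≥0} (hw : Measurable w) {φ : Rn n → ℂ}
    (hφ : AEStronglyMeasurable φ volume) {c : ℝ≥0∞}
    (h : ∀ N : ℕ, weightedMass (fun x => min (w x) N) φ ≤ c) : weightedMass w φ ≤ c := by
  have hsup : ∀ x, (w x : ℝ≥0∞) * ‖φ x‖ₑ =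
      ⨆ N : ℕ, ((min (w x) N : ℝ≥0) : ℝ≥0∞) * ‖φ x‖ₑ := by
    intro x
    refine le_antisymm ?_ (iSup_le fun N => by gcongr; exact min_le_left _ _)
    obtain ⟨N, hN⟩ := exists_nat_ge (w x)
    refine le_trans ?_ (le_iSup _ N)
    rw [min_eq_left hN]
  unfold weightedMass
  simp_rw [hsup]
  rw [lintegral_iSup']
  · exact iSup_le h
  · exact fun N => (hw.min measurable_const).coe_nnreal_ennreal.aemeasurable.mul hφ.enorm
  · refine Eventually.of_forall fun x N N' hNN' => ?_
    dsimp only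
    gcongr

/-- The constant depends on the weight only through `D`: this allows truncated weights to
approximate unbounded ones, and gives uniform bounds for a family of weights. -/
theorem exists_weightedMass_le {ν : ℂ} (hν : 0 < ν.re) {f : ℂ → ℂ} (hf : Continuous f)
    {u₀ : Rn n → ℂ} {u : ℝ → Rn n → ℂ} (hu₀ : MemLp u₀ 1 volume)
    (hu : BoundedContinuousInto 1 (Ici 0) u)
    (hdu : ∀ t, 0 < t → DuhamelAt 1 ν f u₀ u t) {b : ℝ → ℝ} (hb : Continuous b)
    (hb0 : ∀ s, 0 ≤ b s) (hbi : Integrable b)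
    (hfb : ∀ s, 0 < s → ∀ᵐ x, ‖f (u s x)‖ ≤ b s * ‖u s x‖) {D : ℝ≥0} (hD : 1 ≤ D) :
    ∃ C : ℝ≥0, ∀ w : Rn n → ℝ≥0, IsQuasiSubadditive D w → ∀ (T : ℝ) (κ : ℝ≥0∞), 0 < T →
      (∀ s ∈ Ioc 0 T, weightedMass w (kernel ν s) ≤ κ) →
      ∀ t ∈ Icc 0 T, weightedMass w (u t) ≤ C * (weightedMass w u₀ + κ) := by
  obtain ⟨g, hg⟩ := exists_lintegral_pow_mul_kernel_le (n := n) hν 0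
  have hg' : ∀ t, 0 < t → weightedMass (n := n) 1 (kernel ν t) ≤ g := by
    intro t ht
    simpa [weightedMass] using hg t ht
  obtain ⟨M, hM⟩ := hu.bounded
  have hM' : ∀ t, 0 ≤ t → weightedMass 1 (u t) ≤ M.toNNReal := by
    intro t ht
    rw [weightedMass_one, ← enorm_lpClass (hu.memLp t ht), ← ofReal_norm]
    exact ENNReal.ofReal_le_ofReal (hM t ht)
  have hUfin : weightedMass 1 u₀ ≠ ∞ := by
    rw [weightedMass_one]
    exact hu₀.eLpNorm_ne_top
  set U := (weightedMass 1 u₀).toNNReal with hU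
  set B := ∫ s, b s with hB
  have hB0 : 0 ≤ B := integral_nonneg hb0
  set C : ℝ := D * (U + g + M.toNNReal * B) * Real.exp (D * g * B) with hC
  have hC0 : 0 ≤ C := by positivity
  refine ⟨C.toNNReal + 1, fun w hw T κ hT hκ t ht => ?_⟩
  by_cases htop : weightedMass w u₀ + κ = ∞
  · rw [htop, ENNReal.mul_top (by simp)]
    exact le_top
  obtain ⟨hWfin, hκfin⟩ := ENNReal.add_ne_top.1 htop
  lift κ to ℝ≥0 using hκfin
  refine weightedMass_le_of_forall_min hw.measurable (hu.memLp t ht.1).1 fun N => ?_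
  have hmin : ∀ φ, weightedMass (fun x => min (w x) N) φ ≤ weightedMass w φ :=
    fun φ => weightedMass_mono (fun x => min_le_left _ _) φ
  refine (weightedMass_le_of_bounded hf hu₀ hu hdu hb hb0 hbi hfb hg'
    (ENNReal.coe_toNNReal hUfin).ge hM' (hw.min_const hD N) (N := N)
    (fun x => min_le_right _ _) hT (fun s hs => (hmin _).trans (hκ s hs))
    ((hmin _).trans (ENNReal.coe_toNNReal hWfin).ge) ht).trans ?_
  rw [← hU, ← hB]
  generalize weightedMass w u₀ = W at hWfin
  lift W to ℝ≥0 using hWfin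
  rw [ENNReal.toNNReal_coe]
  have hle : D * (κ * U + g * W + κ * M.toNNReal * B) * Real.exp (D * g * B) ≤ C * (W + κ) := by
    rw [hC]
    have : (κ * U + g * W + κ * M.toNNReal * B : ℝ) ≤ (U + g + M.toNNReal * B) * (W + κ) := by
      have h1 : (0 : ℝ) ≤ U * W := by positivity
      have h2 : (0 : ℝ) ≤ g * κ := by positivity
      have h3 : (0 : ℝ) ≤ M.toNNReal * B * W := by positivity
      linarith
    calc _ ≤ D * ((U + g + M.toNNReal * B) * (W + κ)) * Real.exp (D * g * B) := by gcongr
      _ = _ := by ring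
  refine (ENNReal.ofReal_le_ofReal hle).trans ?_
  rw [ENNReal.ofReal_mul hC0, ← NNReal.coe_add, ENNReal.ofReal_coe_nnreal, ENNReal.coe_add]
  gcongr
  change (C.toNNReal : ℝ≥0∞) ≤ _
  rw [ENNReal.coe_add]
  exact le_self_add

/-! ### Power weights and tail weights -/

/-- The weight `|x| ^ m`. -/
noncomputable def powWeight (m : ℕ) (x : Rn n) : ℝ≥0 := ‖x‖₊ ^ m

/-- The weight `|x| ^ m * min 1 (|x| / R)`. It agrees with `|x| ^ m` for `|x| ≥ R` and is at most
`|x| ^ (m + 1) / R`; unlike the cut-off `1_{|x| ≥ R} |x| ^ m` it is quasi-subadditive with a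
constant that does not depend on `R`. -/
noncomputable def tailWeight (m : ℕ) (R : ℝ≥0) (x : Rn n) : ℝ≥0 :=
  ‖x‖₊ ^ m * min 1 (‖x‖₊ / R)

lemma isQuasiSubadditive_radial {θ : ℝ≥0 → ℝ≥0} (hm : Monotone θ) {D : ℝ≥0}
    (hD : ∀ r, θ (2 * r) ≤ D * θ r) : IsQuasiSubadditive D fun x : Rn n => θ ‖x‖₊ := by
  refine ⟨hm.measurable.comp measurable_nnnorm, fun x y => ?_⟩
  have hle : ‖x + y‖₊ ≤ 2 * max ‖x‖₊ ‖y‖₊ := by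
    rw [two_mul]
    exact (nnnorm_add_le x y).trans (add_le_add (le_max_left _ _) (le_max_right _ _))
  refine (hm hle).trans ((hD _).trans ?_)
  gcongr
  rcases max_choice ‖x‖₊ ‖y‖₊ with h | h <;> rw [h]
  · exact le_self_add
  · exact le_add_self

lemma isQuasiSubadditive_powWeight (m : ℕ) :
    IsQuasiSubadditive (2 ^ m) (powWeight m : Rn n → ℝ≥0) :=
  isQuasiSubadditive_radial (θ := fun r => r ^ m) (fun _ _ h => by dsimp only; gcongr)
    fun r => (mul_pow 2 r m).le

lemma isQuasiSubadditive_tailWeight (m : ℕ) (R : ℝ≥0) :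
    IsQuasiSubadditive (2 ^ (m + 1)) (tailWeight m R : Rn n → ℝ≥0) := by
  refine isQuasiSubadditive_radial (θ := fun r => r ^ m * min 1 (r / R))
    (fun _ _ h => by dsimp only; gcongr) fun r => ?_
  have h : min 1 (2 * r / R) ≤ 2 * min 1 (r / R) := by
    rw [mul_min_of_nonneg _ _ zero_le_two, mul_div_assoc]
    exact min_le_min_right _ (by norm_num)
  calc (2 * r) ^ m * min 1 (2 * r / R) ≤ (2 * r) ^ m * (2 * min 1 (r / R)) := by gcongr
    _ = _ := by ring

lemma tailWeight_le_powWeight (m : ℕ) (R : ℝ≥0) (x : Rn n) :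
    tailWeight m R x ≤ powWeight m x := mul_le_of_le_one_right' (min_le_left _ _)

lemma tailWeight_le_powWeight_succ (m : ℕ) (R : ℝ≥0) (x : Rn n) :
    tailWeight m R x ≤ R⁻¹ * powWeight (m + 1) x := by
  refine (mul_le_mul_right (min_le_right _ _) _).trans (le_of_eq ?_)
  rw [powWeight, pow_succ, div_eq_mul_inv]
  ring

lemma powWeight_le_add_tailWeight (m : ℕ) {R : ℝ≥0} (hR : 0 < R) (x : Rn n) :
    powWeight m x ≤ R ^ m + tailWeight m R x := by
  rcases le_total ‖x‖₊ R with h | h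
  · exact le_add_right (pow_le_pow_left₀ zero_le h m)
  · refine le_add_left (le_of_eq ?_)
    rw [tailWeight, min_eq_left ((one_le_div hR).2 h), mul_one, powWeight]

lemma powWeight_le_one_add {k m : ℕ} (hkm : k ≤ m) (x : Rn n) :
    powWeight k x ≤ 1 + powWeight m x := by
  rcases le_total ‖x‖₊ 1 with h | h
  · exact le_add_right (pow_le_one₀ zero_le h)
  · exact le_add_left (pow_le_pow_right₀ h hkm)

lemma weightedMass_const_mul (c : ℝ≥0) (w : Rn n → ℝ≥0) (φ : Rn n → ℂ) :
    weightedMass (fun x => c * w x) φ = c * weightedMass w φ := by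
  unfold weightedMass
  rw [← lintegral_const_mul' _ _ ENNReal.coe_ne_top]
  simp_rw [ENNReal.coe_mul, mul_assoc]

lemma weightedMass_const_add (c : ℝ≥0) (w : Rn n → ℝ≥0) {φ : Rn n → ℂ}
    (hφ : AEStronglyMeasurable φ volume) :
    weightedMass (fun x => c + w x) φ = c * weightedMass 1 φ + weightedMass w φ := by
  rw [← weightedMass_const_mul]
  simp only [weightedMass, Pi.one_apply, mul_one, ENNReal.coe_add, add_mul]
  exact lintegral_add_left' (hφ.enorm.const_mul _) _

lemma weightedMass_sub_le {w : Rn n → ℝ≥0} (hw : Measurable w) {φ ψ : Rn n → ℂ}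
    (hφ : AEStronglyMeasurable φ volume) :
    weightedMass w (φ - ψ) ≤ weightedMass w φ + weightedMass w ψ := by
  unfold weightedMass
  have hm : AEMeasurable (fun x => w x * ‖φ x‖ₑ) volume :=
    hw.coe_nnreal_ennreal.aemeasurable.mul hφ.enorm
  rw [← lintegral_add_left' hm]
  refine lintegral_mono fun x => ?_
  rw [← mul_add]
  gcongr
  exact enorm_sub_le

lemma weightedMass_powWeight_le_add {k m : ℕ} (hkm : k ≤ m) {φ : Rn n → ℂ}
    (hφ : AEStronglyMeasurable φ volume) :
    weightedMass (powWeight k) φ ≤ weightedMass 1 φ + weightedMass (powWeight m) φ := by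
  have := weightedMass_const_add 1 (powWeight m) hφ
  rw [ENNReal.coe_one, one_mul] at this
  rw [← this]
  exact weightedMass_mono (powWeight_le_one_add hkm) φ

lemma exists_weightedMass_powWeight_kernel_le {ν : ℂ} (hν : 0 < ν.re) (k : ℕ) :
    ∃ C : ℝ≥0, ∀ t : ℝ, 0 < t → weightedMass (n := n) (powWeight k) (kernel ν t) ≤
      C * ENNReal.ofReal (t ^ ((k : ℝ) / 2)) := by
  obtain ⟨C, hC⟩ := exists_lintegral_pow_mul_kernel_le (n := n) hν k
  refine ⟨C, fun t ht => ?_⟩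
  refine le_of_eq_of_le (lintegral_congr fun x => ?_) (hC t ht)
  rw [powWeight, ENNReal.coe_pow]
  rfl

lemma tendsto_inv_natCast_add_one : Tendsto (fun N : ℕ => ((N : ℝ≥0) + 1)⁻¹) atTop (𝓝 0) := by
  rw [← NNReal.tendsto_coe]
  simpa using tendsto_one_div_add_atTop_nhds_zero_nat (𝕜 := ℝ)

/-- Dominated convergence, with `|x| ^ m |φ|` as the dominating function. -/
lemma tendsto_weightedMass_tailWeight (m : ℕ) {φ : Rn n → ℂ}
    (hφ : AEStronglyMeasurable φ volume) (hfin : weightedMass (powWeight m) φ ≠ ∞) :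
    Tendsto (fun N : ℕ => weightedMass (tailWeight m (N + 1)) φ) atTop (𝓝 0) := by
  have h0 : (0 : ℝ≥0∞) = ∫⁻ _ : Rn n, 0 := by simp
  rw [h0]
  refine tendsto_lintegral_of_dominated_convergence' (fun x => powWeight m x * ‖φ x‖ₑ)
    (fun N => ((isQuasiSubadditive_tailWeight m _).measurable.coe_nnreal_ennreal.aemeasurable).mul
      hφ.enorm) (fun N => Eventually.of_forall fun x => ?_) hfin
    (Eventually.of_forall fun x => ?_)
  · dsimp only
    gcongr
    exact tailWeight_le_powWeight _ _ _
  · have h1 : Tendsto (fun N : ℕ => ((N : ℝ≥0) + 1)⁻¹ * powWeight (m + 1) x) atTop (𝓝 0) := by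
      simpa using tendsto_inv_natCast_add_one.mul_const (powWeight (m + 1) x)
    have h3 : Tendsto (fun N : ℕ => tailWeight m ((N : ℝ≥0) + 1) x) atTop (𝓝 0) :=
      tendsto_of_tendsto_of_tendsto_of_le_of_le tendsto_const_nhds h1 (fun _ => zero_le)
        fun N => tailWeight_le_powWeight_succ m _ x
    have h4 := ENNReal.Tendsto.mul_const (b := ‖φ x‖ₑ) (ENNReal.tendsto_coe.2 h3)
      (Or.inr enorm_ne_top)
    simpa using h4

/-! ### The space `L¹_m` in terms of the radial weight -/

lemma continuous_monomial (α : Fin n → ℕ) : Continuous (monomial α) := by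
  unfold monomial
  fun_prop

lemma norm_monomial_le (α : Fin n → ℕ) (x : Rn n) : ‖monomial α x‖ ≤ ‖x‖ ^ ∑ j, α j := by
  rw [monomial, norm_prod, ← Finset.prod_pow_eq_pow_sum]
  refine Finset.prod_le_prod (fun _ _ => norm_nonneg _) fun j _ => ?_
  rw [norm_pow]
  gcongr
  exact PiLp.norm_apply_le x j

lemma eLpNorm_weighted_le {α : Fin n → ℕ} {k : ℕ} (hα : ∑ j, α j = k) (φ : Rn n → ℂ) :
    eLpNorm (weighted α φ) 1 volume ≤ weightedMass (powWeight k) φ := by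
  rw [eLpNorm_one_eq_lintegral_enorm]
  refine lintegral_mono fun x => ?_
  rw [weighted, enorm_mul]
  gcongr
  have := norm_monomial_le α x
  rw [hα, ← Complex.norm_real] at this
  exact ENNReal.coe_le_coe.2 (by exact_mod_cast this)

lemma mem_multiIndices {k : ℕ} {α : Fin n → ℕ} : α ∈ multiIndices n k ↔ ∑ j, α j = k := by
  simp [multiIndices, Finset.mem_piAntidiag]

lemma norm_pow_le_sum (m : ℕ) (x : Rn n) :
    ‖x‖ ^ (m + 1) ≤ (n : ℝ) ^ m * ∑ j, |x j| ^ (m + 1) := by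
  have h1 : ‖x‖ ≤ ∑ j, |x j| := by
    rw [EuclideanSpace.norm_eq, Real.sqrt_le_left (by positivity)]
    simp_rw [Real.norm_eq_abs]
    exact Finset.sum_sq_le_sq_sum_of_nonneg fun _ _ => abs_nonneg _
  refine (pow_le_pow_left₀ (norm_nonneg x) h1 _).trans ?_
  simpa using pow_sum_le_card_mul_sum_pow (s := Finset.univ) (f := fun j => |x j|)
    (fun _ _ => abs_nonneg _) m

lemma weighted_single (m : ℕ) (j : Fin n) (φ : Rn n → ℂ) (x : Rn n) :
    weighted (Pi.single j m) φ x = ((x j ^ m : ℝ) : ℂ) * φ x := by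
  have : monomial (Pi.single j m) x = x j ^ m := by
    rw [monomial, Finset.prod_eq_single j]
    · simp
    · intro i _ hi
      simp [Pi.single_eq_of_ne hi]
    · simp
  rw [weighted, this]

lemma MemL1m.weightedMass_powWeight_ne_top {m : ℕ} (hm : 1 ≤ m) {φ : Rn n → ℂ}
    (hφ : MemL1m m φ) : weightedMass (powWeight m) φ ≠ ∞ := by
  obtain ⟨m, rfl⟩ := Nat.exists_eq_add_of_le' hm
  have hsum : ∑ j : Fin n, eLpNorm (weighted (Pi.single j (m + 1)) φ) 1 volume ≠ ∞ :=
    ENNReal.sum_ne_top.2 fun j _ => (hφ.2 _ (by simp)).eLpNorm_ne_top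
  have hle : weightedMass (powWeight (m + 1)) φ ≤
      ENNReal.ofReal ((n : ℝ) ^ m) *
        ∑ j : Fin n, eLpNorm (weighted (Pi.single j (m + 1)) φ) 1 volume := by
    simp_rw [eLpNorm_one_eq_lintegral_enorm]
    rw [← lintegral_finsetSum' _ fun j _ => (hφ.2 _ (by simp)).1.enorm,
      ← lintegral_const_mul' _ _ ENNReal.ofReal_ne_top]
    refine lintegral_mono fun x => ?_
    have h1 : ∀ j : Fin n, ‖weighted (Pi.single j (m + 1)) φ x‖ₑ =
        ENNReal.ofReal (|x j| ^ (m + 1)) * ‖φ x‖ₑ := by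
      intro j
      rw [weighted_single, enorm_mul, ← ofReal_norm, Complex.norm_real, norm_pow,
        Real.norm_eq_abs]
    simp_rw [h1]
    rw [← Finset.sum_mul, ← mul_assoc, ← ENNReal.ofReal_sum_of_nonneg fun _ _ => by positivity,
      ← ENNReal.ofReal_mul (by positivity)]
    gcongr
    rw [← ENNReal.ofReal_coe_nnreal]
    refine ENNReal.ofReal_le_ofReal ?_
    simpa [powWeight] using norm_pow_le_sum m x
  exact ne_top_of_le_ne_top (ENNReal.mul_ne_top ENNReal.ofReal_ne_top hsum) hle

lemma exists_normL1m_le (m : ℕ) : ∃ c : ℕ, 0 < c ∧ ∀ φ : Rn n → ℂ,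
    AEStronglyMeasurable φ volume →
      normL1m m φ ≤ c * (weightedMass 1 φ + weightedMass (powWeight m) φ) := by
  refine ⟨(∑ k ∈ Finset.range (m + 1), (multiIndices n k).card) + 1, by omega, fun φ hφ => ?_⟩
  calc normL1m m φ ≤ ∑ k ∈ Finset.range (m + 1), ∑ _α ∈ multiIndices n k,
        (weightedMass 1 φ + weightedMass (powWeight m) φ) := by
        refine Finset.sum_le_sum fun k hk => Finset.sum_le_sum fun α hα => ?_
        refine (eLpNorm_weighted_le (mem_multiIndices.1 hα) φ).trans ?_
        exact weightedMass_powWeight_le_add (Nat.lt_succ_iff.1 (Finset.mem_range.1 hk)) hφ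
    _ = (∑ k ∈ Finset.range (m + 1), (multiIndices n k).card : ℕ) *
        (weightedMass 1 φ + weightedMass (powWeight m) φ) := by
        simp only [Finset.sum_const, nsmul_eq_mul]
        rw [← Finset.sum_mul]
        push_cast
        rfl
    _ ≤ _ := by
        gcongr
        omega

lemma memL1m_of_weightedMass_ne_top {m : ℕ} {φ : Rn n → ℂ} (hφ : MemLp φ 1 volume)
    (h : weightedMass (powWeight m) φ ≠ ∞) : MemL1m m φ := by
  refine ⟨hφ, fun α hα => ⟨?_, ?_⟩⟩
  · exact (Complex.continuous_ofReal.comp (continuous_monomial α)).aestronglyMeasurable.mul hφ.1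
  · refine (eLpNorm_weighted_le rfl φ).trans_lt
      ((weightedMass_powWeight_le_add hα hφ.1).trans_lt ?_)
    rw [weightedMass_one]
    exact ENNReal.add_lt_top.2 ⟨hφ.eLpNorm_lt_top, h.lt_top⟩

/-! ### The nonlinearity along a decaying solution -/

lemma continuous_of_local_lipschitz {f : ℂ → ℂ} {K p : ℝ} (hp : 1 < p)
    (hf : ∀ ξ η : ℂ, ‖f ξ - f η‖ ≤ K * (‖ξ‖ ^ (p - 1) + ‖η‖ ^ (p - 1)) * ‖ξ - η‖) :
    Continuous f := by
  refine continuous_iff_continuousAt.2 fun η => ?_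
  rw [ContinuousAt, tendsto_iff_norm_sub_tendsto_zero]
  have hc : Continuous fun ξ : ℂ => K * (‖ξ‖ ^ (p - 1) + ‖η‖ ^ (p - 1)) * ‖ξ - η‖ := by
    have : Continuous fun ξ : ℂ => ‖ξ‖ ^ (p - 1) :=
      continuous_norm.rpow_const fun _ => Or.inr (by linarith)
    fun_prop
  refine squeeze_zero (fun _ => norm_nonneg _) (fun ξ => hf ξ η) ?_
  simpa using hc.tendsto η

lemma norm_le_rpow_mul {f : ℂ → ℂ} {K p : ℝ} (hp : 1 < p) (hf0 : f 0 = 0)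
    (hf : ∀ ξ η : ℂ, ‖f ξ - f η‖ ≤ K * (‖ξ‖ ^ (p - 1) + ‖η‖ ^ (p - 1)) * ‖ξ - η‖) (ξ : ℂ) :
    ‖f ξ‖ ≤ K * ‖ξ‖ ^ (p - 1) * ‖ξ‖ := by
  have := hf ξ 0
  rwa [hf0, sub_zero, sub_zero, norm_zero, Real.zero_rpow (by linarith), add_zero] at this

lemma exists_ae_norm_le_of_decay {u : ℝ → Rn n → ℂ} (hu : BoundedContinuousInto ∞ (Ioi 0) u)
    (hdecay : DecaysLikeFree u) :
    ∃ M : ℝ, 0 ≤ M ∧ ∀ t, 0 < t → ∀ᵐ x, ‖u t x‖ ≤ M * (1 + t) ^ (-((n : ℝ) / 2)) := by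
  obtain ⟨M₁, hM₁⟩ := hu.bounded
  unfold DecaysLikeFree at hdecay
  set S := ⨆ q ∈ Ici (1 : ℝ≥0∞), ⨆ t ∈ Ioi (0 : ℝ),
    ENNReal.ofReal (t ^ ((n : ℝ) / 2 * (1 - (q⁻¹).toReal))) * eLpNorm (u t) q volume with hS
  have hM₁0 : 0 ≤ M₁ := (norm_nonneg _).trans (hM₁ 1 (mem_Ioi.2 one_pos))
  refine ⟨2 ^ ((n : ℝ) / 2) * (M₁ + S.toReal), by positivity, fun t ht => ?_⟩
  have hdec : ENNReal.ofReal (t ^ ((n : ℝ) / 2)) * eLpNorm (u t) ∞ volume ≤ S := by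
    have h1 := le_iSup₂_of_le (f := fun q (_ : q ∈ Ici (1 : ℝ≥0∞)) => ⨆ t ∈ Ioi (0 : ℝ),
      ENNReal.ofReal (t ^ ((n : ℝ) / 2 * (1 - (q⁻¹).toReal))) * eLpNorm (u t) q volume)
      ∞ (mem_Ici.2 le_top) (le_iSup₂_of_le (f := fun t (_ : t ∈ Ioi (0 : ℝ)) =>
      ENNReal.ofReal (t ^ ((n : ℝ) / 2 * (1 - ((∞ : ℝ≥0∞)⁻¹).toReal))) * eLpNorm (u t) ∞ volume)
      t ht le_rfl)
    rwa [ENNReal.inv_top, ENNReal.toReal_zero, sub_zero, mul_one] at h1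
  have hbd : eLpNorm (u t) ∞ volume ≤ ENNReal.ofReal M₁ := by
    rw [← enorm_lpClass (hu.memLp t ht), ← ofReal_norm]
    exact ENNReal.ofReal_le_ofReal (hM₁ t ht)
  rw [eLpNorm_exponent_top] at hdec hbd
  filter_upwards [ae_le_eLpNormEssSup (f := u t) (μ := volume)] with x hx
  have hx1 : ‖u t x‖ ≤ M₁ := by
    rw [← ENNReal.ofReal_le_ofReal_iff hM₁0, ofReal_norm]
    exact hx.trans hbd
  have htn : 0 ≤ t ^ ((n : ℝ) / 2) := by positivity
  have hx2 : t ^ ((n : ℝ) / 2) * ‖u t x‖ ≤ S.toReal := by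
    rw [← ENNReal.ofReal_le_iff_le_toReal hdecay.ne, ENNReal.ofReal_mul htn, ofReal_norm]
    exact (mul_le_mul_right hx _).trans hdec
  have h2 : (1 + t) ^ ((n : ℝ) / 2) ≤ 2 ^ ((n : ℝ) / 2) * (1 + t ^ ((n : ℝ) / 2)) := by
    have hmax : (1 + t) ≤ 2 * max 1 t := by linarith [le_max_left 1 t, le_max_right 1 t]
    refine (Real.rpow_le_rpow (by positivity) hmax (by positivity)).trans ?_
    rw [Real.mul_rpow (by norm_num) (by positivity)]
    gcongr
    rcases max_choice 1 t with h | h <;> rw [h]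
    · rw [Real.one_rpow]
      linarith
    · linarith
  rw [Real.rpow_neg (by positivity), ← div_eq_mul_inv, le_div_iff₀ (by positivity)]
  calc ‖u t x‖ * (1 + t) ^ ((n : ℝ) / 2)
      ≤ ‖u t x‖ * (2 ^ ((n : ℝ) / 2) * (1 + t ^ ((n : ℝ) / 2))) := by gcongr
    _ = 2 ^ ((n : ℝ) / 2) * (‖u t x‖ + t ^ ((n : ℝ) / 2) * ‖u t x‖) := by ring
    _ ≤ _ := by gcongr

/-- The condition `p > 1 + 2 / n` is what makes the linear growth rate `‖u(s)‖_∞ ^ (p - 1)`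
integrable in time. -/
lemma exists_integrable_rate (hn : 1 ≤ n) {p : ℝ} (hp : 1 + 2 / (n : ℝ) < p) {f : ℂ → ℂ}
    (hf0 : f 0 = 0) {K : ℝ} (hK : 0 < K)
    (hf : ∀ ξ η : ℂ, ‖f ξ - f η‖ ≤ K * (‖ξ‖ ^ (p - 1) + ‖η‖ ^ (p - 1)) * ‖ξ - η‖)
    {u : ℝ → Rn n → ℂ} (hu : BoundedContinuousInto ∞ (Ioi 0) u) (hdecay : DecaysLikeFree u) :
    ∃ b : ℝ → ℝ, Continuous b ∧ (∀ s, 0 ≤ b s) ∧ Integrable b ∧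
      ∀ s, 0 < s → ∀ᵐ x, ‖f (u s x)‖ ≤ b s * ‖u s x‖ := by
  have hn0 : (0 : ℝ) < n := by exact_mod_cast hn
  have hp1 : 1 < p := by
    have : 0 < 2 / (n : ℝ) := by positivity
    linarith
  obtain ⟨M, hM0, hM⟩ := exists_ae_norm_le_of_decay hu hdecay
  set γ := (n : ℝ) / 2 * (p - 1) with hγ
  have hγ1 : 1 < γ := by
    have h1 : 2 / (n : ℝ) < p - 1 := by linarith
    calc (1 : ℝ) = (n : ℝ) / 2 * (2 / n) := by field_simp
      _ < γ := by rw [hγ]; gcongr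
  have hpos : ∀ s : ℝ, 0 < 1 + ‖s‖ := fun s => by positivity
  refine ⟨fun s => K * M ^ (p - 1) * (1 + ‖s‖) ^ (-γ), ?_, fun s => by positivity, ?_, ?_⟩
  · exact continuous_const.mul
      ((continuous_const.add continuous_norm).rpow_const fun s => Or.inl (hpos s).ne')
  · exact (integrable_one_add_norm (by simpa using hγ1)).const_mul _
  · intro s hs
    filter_upwards [hM s hs] with x hx
    refine (norm_le_rpow_mul hp1 hf0 hf _).trans ?_
    rw [mul_assoc K (M ^ (p - 1)), Real.norm_of_nonneg hs.le]
    refine mul_le_mul_of_nonneg_right (mul_le_mul_of_nonneg_left ?_ hK.le) (norm_nonneg _)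
    calc ‖u s x‖ ^ (p - 1) ≤ (M * (1 + s) ^ (-((n : ℝ) / 2))) ^ (p - 1) :=
          Real.rpow_le_rpow (norm_nonneg _) hx (by linarith)
      _ = _ := by
          rw [Real.mul_rpow hM0 (by positivity), ← Real.rpow_mul (by positivity),
            hγ, neg_mul]

/-! ### Continuity in `L¹_m` from uniformly small tails -/

/-- Continuity in `L¹` together with locally uniformly small tails gives continuity in `L¹_m`. -/
lemma tendsto_normL1m_sub {m : ℕ} {u : ℝ → Rn n → ℂ} (hu : BoundedContinuousInto 1 (Ici 0) u)
    (htail : ∀ T : ℝ, 0 < T → ∀ ε : ℝ≥0∞, 0 < ε → ∃ R : ℝ≥0, 0 < R ∧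
      ∀ t ∈ Icc 0 T, weightedMass (tailWeight m R) (u t) ≤ ε) {t : ℝ} (ht : 0 ≤ t) :
    Tendsto (fun s => normL1m m (u s - u t)) (𝓝[Ici 0] t) (𝓝 0) := by
  obtain ⟨c, hc0, hc⟩ := exists_normL1m_le (n := n) m
  have hL1 : Tendsto (fun s => weightedMass 1 (u s - u t)) (𝓝[Ici 0] t) (𝓝 0) := by
    have h1 : Tendsto (fun s => ‖lpClass 1 (u s) - lpClass 1 (u t)‖ₑ) (𝓝[Ici 0] t) (𝓝 0) := by
      have := (Tendsto.sub (hu.continuousOn t ht)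
        (tendsto_const_nhds (x := lpClass 1 (u t)))).enorm
      rwa [sub_self, enorm_zero] at this
    refine h1.congr' ?_
    filter_upwards [self_mem_nhdsWithin] with s hs
    rw [lpClass_of_memLp (hu.memLp s hs), lpClass_of_memLp (hu.memLp t ht), ← MemLp.toLp_sub,
      Lp.enorm_toLp, weightedMass_one]
  rw [ENNReal.tendsto_nhds_zero]
  intro ε hε
  have hcne : (c * 3 : ℝ≥0∞) ≠ ∞ := by finiteness
  set δ := ε / (c * 3) with hδ
  have hδ0 : 0 < δ := ENNReal.div_pos hε.ne' hcne
  obtain ⟨R, hR, hRt⟩ := htail (t + 1) (by linarith) δ hδ0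
  have hL1' : Tendsto (fun s => ((1 + R ^ m : ℝ≥0) : ℝ≥0∞) * weightedMass 1 (u s - u t))
      (𝓝[Ici 0] t) (𝓝 0) := by
    have := ENNReal.Tendsto.const_mul hL1 (Or.inr (ENNReal.coe_ne_top (r := 1 + R ^ m)))
    rwa [mul_zero] at this
  have hclose : ∀ᶠ s in 𝓝[Ici 0] t, s < t + 1 :=
    nhdsWithin_le_nhds (Iio_mem_nhds (by linarith))
  filter_upwards [self_mem_nhdsWithin, hclose, (ENNReal.tendsto_nhds_zero.1 hL1') δ hδ0]
    with s hs hst hsδ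
  have hms := (hu.memLp s hs).1
  have hm := hms.sub (hu.memLp t ht).1
  have h1 : weightedMass (powWeight m) (u s - u t) ≤
      (R ^ m : ℝ≥0) * weightedMass 1 (u s - u t) + (δ + δ) := by
    refine (weightedMass_mono (powWeight_le_add_tailWeight m hR) _).trans ?_
    rw [weightedMass_const_add _ _ hm]
    gcongr
    refine (weightedMass_sub_le (isQuasiSubadditive_tailWeight m R).measurable hms).trans ?_
    exact add_le_add (hRt s ⟨hs, hst.le⟩) (hRt t ⟨ht, by linarith⟩)
  calc normL1m m (u s - u t)
      ≤ c * (weightedMass 1 (u s - u t) +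
        ((R ^ m : ℝ≥0) * weightedMass 1 (u s - u t) + (δ + δ))) := (hc _ hm).trans (by gcongr)
    _ = c * (((1 + R ^ m : ℝ≥0) : ℝ≥0∞) * weightedMass 1 (u s - u t) + (δ + δ)) := by
        rw [ENNReal.coe_add, ENNReal.coe_one]
        ring
    _ ≤ c * (δ + (δ + δ)) := by gcongr
    _ = (c * 3) * δ := by ring
    _ ≤ ε := ENNReal.mul_div_le

end CGL

/-! ### Moments and continuity of the solution -/

open CGL in
theorem theorem1p2 (n : ℕ) (hn : 1 ≤ n) (ν : ℂ) (hν : 0 < ν.re)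
    (p : ℝ) (hp : 1 + 2 / (n : ℝ) < p)
    (f : ℂ → ℂ) (hf0 : f 0 = 0)
    (hf : ∃ K : ℝ, 0 < K ∧
      ∀ ξ η : ℂ, ‖f ξ - f η‖ ≤ K * (‖ξ‖ ^ (p - 1) + ‖η‖ ^ (p - 1)) * ‖ξ - η‖)
    (m : ℕ) (hm : 1 ≤ m)
    (u₀ : CGL.Rn n → ℂ) (hu₀ : CGL.MemL1m m u₀) (hu₀' : MemLp u₀ ∞ volume)
    (u : ℝ → CGL.Rn n → ℂ) (hu : CGL.IsGlobalMildSolution ν f u₀ u)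
    (hdecay : CGL.DecaysLikeFree u) :
    CGL.ContinuousIntoL1m m u ∧
      ∃ C : ℝ, 0 < C ∧ ∀ t : ℝ, 0 < t →
        ∑ α ∈ CGL.multiIndices n m, eLpNorm (CGL.weighted α (u t)) 1 volume ≤
          ENNReal.ofReal (C * (1 + t ^ ((m : ℝ) / 2))) := by
  obtain ⟨K, hK, hfK⟩ := hf
  have hn0 : (0 : ℝ) < n := by exact_mod_cast hn
  have hp1 : 1 < p := by
    have : 0 < 2 / (n : ℝ) := by positivity
    linarith
  have hfc : Continuous f := continuous_of_local_lipschitz hp1 hfK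
  have hu1 := hu.memX.1
  obtain ⟨b, hb, hb0, hbi, hfb⟩ := exists_integrable_rate hn hp hf0 hK hfK hu.memX.2 hdecay
  -- the constants `2 ^ m` and `2 ^ (m + 1)` belong to the power and the tail weights
  have hbound := fun (k : ℕ) => exists_weightedMass_le hν hfc hu₀.1 hu1
    (fun t ht => (hu.duhamel t ht).1) hb hb0 hbi hfb (D := 2 ^ k) (one_le_pow₀ one_le_two)
  have hW := hu₀.weightedMass_powWeight_ne_top hm
  obtain ⟨C₁, hC₁⟩ := hbound m
  obtain ⟨G₁, hG₁⟩ := exists_weightedMass_powWeight_kernel_le (n := n) hν m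
  have hmoment : ∀ T, 0 < T → ∀ t ∈ Icc 0 T, weightedMass (powWeight m) (u t) ≤
      C₁ * (weightedMass (powWeight m) u₀ + G₁ * ENNReal.ofReal (T ^ ((m : ℝ) / 2))) := by
    intro T hT
    refine hC₁ _ (isQuasiSubadditive_powWeight m) T _ hT fun s hs => (hG₁ s hs.1).trans ?_
    gcongr
    · exact hs.1.le
    · exact hs.2
  refine ⟨⟨fun t ht => ?_, fun t ht => tendsto_normL1m_sub hu1 ?_ ht⟩, ?_⟩
  · refine memL1m_of_weightedMass_ne_top (hu1.memLp t ht) ?_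
    refine ne_top_of_le_ne_top ?_ (hmoment (t + 1) (by linarith) t ⟨ht, by linarith⟩)
    finiteness
  · intro T hT ε hε
    obtain ⟨C₂, hC₂⟩ := hbound (m + 1)
    obtain ⟨G₂, hG₂⟩ := exists_weightedMass_powWeight_kernel_le (n := n) hν (m + 1)
    set κ : ℝ≥0∞ := G₂ * ENNReal.ofReal (T ^ (((m + 1 : ℕ) : ℝ) / 2)) with hκ
    have hκfin : κ ≠ ∞ := by finiteness
    have hlim : Tendsto (fun N : ℕ => (C₂ : ℝ≥0∞) *
        (weightedMass (tailWeight m ((N : ℝ≥0) + 1)) u₀ +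
          (((N : ℝ≥0) + 1)⁻¹ : ℝ≥0) * κ)) atTop (𝓝 0) := by
      have h3 := ENNReal.Tendsto.mul_const (b := κ)
        (ENNReal.tendsto_coe.2 tendsto_inv_natCast_add_one) (Or.inr hκfin)
      have h4 := (tendsto_weightedMass_tailWeight m hu₀.1.1 hW).add h3
      simpa using ENNReal.Tendsto.const_mul h4 (Or.inr (ENNReal.coe_ne_top (r := C₂)))
    obtain ⟨N, hN⟩ := ((ENNReal.tendsto_nhds_zero.1 hlim) ε hε).exists
    refine ⟨N + 1, by positivity, fun t ht => (hC₂ _ (isQuasiSubadditive_tailWeight m _) T _ hT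
      (fun s hs => ?_) t ht).trans hN⟩
    refine (weightedMass_mono (tailWeight_le_powWeight_succ m _) _).trans ?_
    rw [weightedMass_const_mul, hκ]
    gcongr
    refine (hG₂ s hs.1).trans ?_
    gcongr
    · exact hs.1.le
    · exact hs.2
  · generalize weightedMass (powWeight m) u₀ = W at hW hmoment
    lift W to ℝ≥0 using hW
    set c := (multiIndices n m).card with hc
    refine ⟨c * (C₁ * (W + G₁)) + 1, by positivity, fun t ht => ?_⟩
    set τ := t ^ ((m : ℝ) / 2) with hτ
    have hτ0 : 0 ≤ τ := by positivity
    calc ∑ α ∈ multiIndices n m, eLpNorm (weighted α (u t)) 1 volume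
        ≤ ∑ _α ∈ multiIndices n m, (C₁ * (W + G₁ * ENNReal.ofReal τ) : ℝ≥0∞) :=
          Finset.sum_le_sum fun α hα => (eLpNorm_weighted_le
            (mem_multiIndices.1 hα) _).trans (hmoment t ht t ⟨ht.le, le_rfl⟩)
      _ = ENNReal.ofReal (c * (C₁ * (W + G₁ * τ))) := by
          rw [Finset.sum_const, nsmul_eq_mul, ENNReal.ofReal_mul (by positivity),
            ENNReal.ofReal_natCast, ENNReal.ofReal_mul (by positivity),
            ENNReal.ofReal_add (by positivity) (by positivity),
            ENNReal.ofReal_mul (by positivity), ENNReal.ofReal_coe_nnreal,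
            ENNReal.ofReal_coe_nnreal, ENNReal.ofReal_coe_nnreal]
      _ ≤ ENNReal.ofReal ((c * (C₁ * (W + G₁)) + 1) * (1 + τ)) := by
          refine ENNReal.ofReal_le_ofReal ?_
          have h1 : (W + G₁ * τ : ℝ) ≤ (W + G₁) * (1 + τ) := by
            have : (0 : ℝ) ≤ W * τ := by positivity
            linarith [G₁.coe_nonneg]
          calc (c * (C₁ * (W + G₁ * τ)) : ℝ) ≤ c * (C₁ * ((W + G₁) * (1 + τ))) := by gcongr
            _ ≤ (c * (C₁ * (W + G₁)) + 1) * (1 + τ) := by linarith
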